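/- Let $\mathbb D=\{z\in\mathbb C:|z|<1\}$ and $\bar{\mathbb D}=\{z\in\mathbb C:|z|\le 1\}$, and let $A(\bar{\mathbb D})$ be the disk algebra, i.e. the algebra of all continuous functions $f:\bar{\mathbb D}\to\mathbb C$ that are analytic on $\mathbb D$, with the metric induced by the supremum norm on $\bar{\mathbb D}$. A Möbius transformation on $\bar{\mathbb D}$ is a map of $\bar{\mathbb D}$ onto itself of the form $z\mapsto (az+b)/(cz+d)$ with $a,b,c,d\in\mathbb C$, $ad-bc\neq 0$ and $cz+d\ne 0$ on $\bar{\mathbb D}$. Suppose that $U$ is a surjective isometry (not assumed to be linear) from $A(\bar{\mathbb D})$ onto itself. Then there exist a Möbius transformation $\varphi$ on $\bar{\mathbb D}$ and a constant $\alpha\in\mathbb C$ with $|\alpha|=1$ such that \[ U(f)=U(0)+\alpha\, f\circ\varphi\quad\text{for all } f\in A(\bar{\mathbb D}), \] or \[ U(f)=U(0)+\alpha\,\overline{f\circ\bar\varphi}\quad\text{for all } f\in A(\bar{\mathbb D}), \] where $\bar\varphi(z)=\overline{\varphi(z)}$. Conversely, if a map $U:A(\bar{\mathbb D})\to A(\bar{\mathbb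 D})$ satisfies one of these two equations for some Möbius transformation $\varphi$ on $\bar{\mathbb D}$ and some unimodular constant $\alpha$, then $U$ is a surjective isometry. Moreover, for every $u\in A(\bar{\mathbb D})$, every such $\varphi$ and every such $\alpha$, the formulas $f\mapsto u+\alpha f\circ\varphi$ and $f\mapsto u+\alpha\overline{f\circ\bar\varphi}$ define maps from $A(\bar{\mathbb D})$ to itself. -/

import Mathlib

/-- The closed unit disk, as a compact metric space. -/
abbrev ClosedDisk : Type := Metric.closedBall (0 : ℂ) 1

/-- The disk algebra: the algebra of all continuous functions on the closed unit disk that are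
holomorphic on the open unit disk. Its metric is inherited from the supremum metric of
`C(ClosedDisk, ℂ)`. A function on the closed disk is regarded as holomorphic on the open disk when
it is the restriction of some `F : ℂ → ℂ` that is differentiable on the open disk (the values of `F`
outside the closed disk play no role). -/
def diskAlgebra : Subalgebra ℂ C(ClosedDisk, ℂ) where
  carrier := {f | ∃ F : ℂ → ℂ, DifferentiableOn ℂ F (Metric.ball 0 1) ∧
    ∀ z : ClosedDisk, f z = F z}
  mul_mem' := by
    rintro f g ⟨F, hF, hf⟩ ⟨G, hG, hg⟩
    exact ⟨F * G, hF.mul hG, fun z => by simp [hf, hg]⟩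
  add_mem' := by
    rintro f g ⟨F, hF, hf⟩ ⟨G, hG, hg⟩
    exact ⟨F + G, hF.add hG, fun z => by simp [hf, hg]⟩
  algebraMap_mem' := fun c =>
    ⟨fun _ => c, differentiableOn_const c, fun z => by simp⟩

/-- A Möbius transformation of the closed unit disk: a nondegenerate fractional linear
transformation, without pole in the closed disk, that maps the closed disk onto itself. -/
def IsMobiusOfDisk (φ : ClosedDisk → ClosedDisk) : Prop :=
  Function.Surjective φ ∧ ∃ a b c d : ℂ, a * d - b * c ≠ 0 ∧
    ∀ z : ClosedDisk, c * (z : ℂ) + d ≠ 0 ∧ (φ z : ℂ) = (a * z + b) / (c * z + d)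

/-- Complex conjugation as a map of the closed unit disk to itself. -/
def conjDisk (z : ClosedDisk) : ClosedDisk :=
  ⟨starRingEnd ℂ (z : ℂ), by
    have h := z.2
    rw [mem_closedBall_zero_iff] at h ⊢
    rwa [RCLike.norm_conj]⟩

/-!
By the Mazur–Ulam theorem, `T = U - U 0` is a real-linear isometry. If `q` has norm `1` and peaks at
a point `y` of the circle, the supremum norm is smooth at `q`, so `f ↦ Re (conj (q y) * f y)` is the
only real-linear functional of norm `1` with value `1` at `q`. Hence the adjoint of `T` carries such
functionals to such functionals, and `(T f) y` is `a * f x` or `a * conj (f x)` with `|a| = 1`. As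
there are no zero divisors, the same alternative holds at every `y`, and conjugating `f` turns the
second one into the first.

Now `T 1` is invertible and unimodular on the circle, so it is constant by the maximum principle,
and `f ↦ T f / T 1` is an algebra automorphism. Such an automorphism is the composition with a
bijection `φ` of the closed disk. If `φ w = 0`, then `φ` and `z - w` divide each other, so
`φ * (1 - conj w * z) / (z - w)` is again invertible and unimodular on the circle: it is a constant,
and `φ` is a Möbius transformation.
-/

open Filter Metric Topology
open scoped ComplexConjugate InnerProductSpace

section Isometries

theorem norm_eq_norm_of_surjective {X Y E F : Type*} [TopologicalSpace X] [CompactSpace X]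
    [TopologicalSpace Y] [CompactSpace Y] [SeminormedAddCommGroup E] [SeminormedAddCommGroup F]
    {f : C(X, E)} {g : C(Y, F)} {φ : Y → X} (hφ : Function.Surjective φ)
    (h : ∀ y, ‖g y‖ = ‖f (φ y)‖) : ‖g‖ = ‖f‖ := by
  refine le_antisymm ((g.norm_le (norm_nonneg f)).2 fun y => ?_)
    ((f.norm_le (norm_nonneg g)).2 (hφ.forall.2 fun y => ?_))
  · exact (h y).trans_le (f.norm_coe_le_norm _)
  · exact (h y).symm.trans_le (g.norm_coe_le_norm y)

theorem isometry_and_surjective_of_eq_add_smul {𝕜 E F : Type*} [PseudoMetricSpace E]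
    [NormedDivisionRing 𝕜] [SeminormedAddCommGroup F] [Module 𝕜 F] [NormSMulClass 𝕜 F] {U : E → F}
    (T : E ≃ᵢ F) {u : F} {α : 𝕜} (hα : ‖α‖ = 1) (h : ∀ x, U x = u + α • T x) :
    Isometry U ∧ Function.Surjective U := by
  refine ⟨Isometry.of_dist_eq fun x y => ?_, fun v => ⟨T.symm (α⁻¹ • (v - u)), ?_⟩⟩
  · rw [h, h, dist_add_left, dist_smul₀, hα, one_mul, T.dist_eq]
  · rw [h, T.apply_symm_apply, smul_inv_smul₀ (norm_ne_zero_iff.1 (hα ▸ one_ne_zero)),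
      add_sub_cancel]

theorem exists_linearIsometryEquiv_eq_add {E F : Type*} [NormedAddCommGroup E] [NormedSpace ℝ E]
    [NormedAddCommGroup F] [NormedSpace ℝ F] {U : E → F} (hU : Isometry U)
    (hsurj : Function.Surjective U) : ∃ T : E ≃ₗᵢ[ℝ] F, ∀ x, U x = U 0 + T x := by
  let e : E ≃ᵢ F := ⟨.ofBijective U ⟨hU.injective, hsurj⟩, hU⟩
  refine ⟨e.toRealLinearIsometryEquiv, fun x => ?_⟩
  rw [e.toRealLinearIsometryEquiv_apply]
  exact (add_sub_cancel _ _).symm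

end Isometries

section PeakFunctions

variable {X E : Type*} [TopologicalSpace X] [NormedAddCommGroup E]

/-- `q` peaks at `x` if its norm is `1` at `x` and less than `1` everywhere else. Any unit vector is
allowed as the value `q x`, so that rotations of peak functions are peak functions. -/
def PeaksAt (q : C(X, E)) (x : X) : Prop :=
  ‖q x‖ = 1 ∧ ∀ y, y ≠ x → ‖q y‖ < 1

namespace PeaksAt

variable {q : C(X, E)} {x : X}

theorem norm_apply_le_one (hq : PeaksAt q x) (y : X) : ‖q y‖ ≤ 1 := by
  rcases eq_or_ne y x with rfl | hy
  exacts [hq.1.le, (hq.2 y hy).le]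

theorem const_smul {𝕜 : Type*} [NormedField 𝕜] [NormedSpace 𝕜 E] (hq : PeaksAt q x) {c : 𝕜}
    (hc : ‖c‖ = 1) : PeaksAt (c • q) x := by
  simpa only [PeaksAt, ContinuousMap.smul_apply, norm_smul, hc, one_mul] using hq

variable [CompactSpace X]

theorem norm_eq_one (hq : PeaksAt q x) : ‖q‖ = 1 :=
  le_antisymm ((ContinuousMap.norm_le _ zero_le_one).2 hq.norm_apply_le_one)
    (hq.1 ▸ q.norm_coe_le_norm x)

variable [InnerProductSpace ℝ E]

/-- Points where `⟪q y, f y⟫` is much larger than `⟪q x, f x⟫` stay away from `x`, so `‖q y‖` stays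
away from `1` there. -/
theorem eventually_norm_add_smul_le (hq : PeaksAt q x) (f : C(X, E)) {ε : ℝ} (hε : 0 < ε) :
    ∀ᶠ t in 𝓝[>] (0 : ℝ), ‖q + t • f‖ ≤ 1 + t * (⟪q x, f x⟫_ℝ + ε) := by
  have : Nonempty X := ⟨x⟩
  set m := ⟪q x, f x⟫_ℝ
  have hm : |m| ≤ ‖f‖ := calc
    |m| ≤ ‖q x‖ * ‖f x‖ := abs_real_inner_le_norm _ _
    _ ≤ ‖f‖ := by rw [hq.1, one_mul]; exact f.norm_coe_le_norm x
  obtain ⟨δ, hδ, hfar⟩ : ∃ δ > 0, ∀ y ∈ {y | m + ε / 2 ≤ ⟪q y, f y⟫_ℝ}, δ ≤ 1 - ‖q y‖ := by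
    refine IsCompact.exists_forall_le' ?_ (by fun_prop) fun y (hy : m + ε / 2 ≤ _) =>
      sub_pos.2 (hq.2 y ?_)
    · exact (isClosed_le continuous_const (by fun_prop)).isCompact
    · rintro rfl
      exact absurd hy (by linarith)
  have hsmall (C : ℝ) {η : ℝ} (hη : 0 < η) : ∀ᶠ t in 𝓝[>] (0 : ℝ), t * C < η := by
    have hlim : Tendsto (fun t : ℝ => t * C) (𝓝 0) (𝓝 0) :=
      Continuous.tendsto' (by fun_prop) _ _ (zero_mul C)
    exact (hlim.mono_left nhdsWithin_le_nhds).eventually_lt_const hη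
  filter_upwards [self_mem_nhdsWithin, hsmall (‖f‖ ^ 2) hε, hsmall (2 * ‖f‖) hδ]
    with t (ht : 0 < t) ht_near ht_far
  refine (ContinuousMap.norm_le_of_nonempty _).2 fun y => ?_
  rcases lt_or_ge ⟪q y, f y⟫_ℝ (m + ε / 2) with hy | hy
  · have hsq : ‖q y + t • f y‖ ^ 2 ≤ 1 + 2 * (t * (m + ε)) := calc
      ‖q y + t • f y‖ ^ 2 = ‖q y‖ ^ 2 + 2 * (t * ⟪q y, f y⟫_ℝ) + t * (t * ‖f y‖ ^ 2) := by
        rw [norm_add_sq_real, real_inner_smul_right, norm_smul, Real.norm_of_nonneg ht.le]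
        ring
      _ ≤ 1 ^ 2 + 2 * (t * (m + ε / 2)) + t * (t * ‖f‖ ^ 2) := by
        gcongr
        exacts [hq.norm_apply_le_one y, f.norm_coe_le_norm y]
      _ ≤ 1 ^ 2 + 2 * (t * (m + ε / 2)) + t * ε := by gcongr
      _ = 1 + 2 * (t * (m + ε)) := by ring
    rw [ContinuousMap.add_apply, ContinuousMap.smul_apply]
    linarith [two_mul_le_add_sq ‖q y + t • f y‖ 1]
  · calc ‖q y + t • f y‖ ≤ ‖q y‖ + t * ‖f y‖ := by
          grw [norm_add_le, norm_smul, Real.norm_of_nonneg ht.le]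
      _ ≤ (1 - δ) + t * ‖f‖ := by
        gcongr
        exacts [by linarith [hfar y hy], f.norm_coe_le_norm y]
      _ ≤ 1 + t * (-‖f‖) := by linarith
      _ ≤ 1 + t * (m + ε) := by gcongr; linarith [neg_le_of_abs_le hm]

end PeaksAt

end PeakFunctions

section FunctionAlgebras

variable {X Y : Type*} [TopologicalSpace X] [TopologicalSpace Y]
  {A : Subalgebra ℂ C(X, ℂ)} {B : Subalgebra ℂ C(Y, ℂ)}

/-- `x` is a peak point of the function algebra `A` if some member of `A` peaks at `x`. -/
def IsPeakPoint (A : Subalgebra ℂ C(X, ℂ)) (x : X) : Prop :=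
  ∃ q : A, PeaksAt q.1 x

theorem exists_apply_eq_and_eq_zero (hA : A.SeparatesPoints) {x y z : X} (hy : x ≠ y) (hz : x ≠ z)
    (c : ℂ) : ∃ f : A, f.1 x = c ∧ f.1 y = 0 ∧ f.1 z = 0 := by
  classical
  obtain ⟨g, hg, hgx, hgy⟩ := hA.strongly (Pi.single x c) x y
  obtain ⟨k, hk, hkx, hkz⟩ := hA.strongly (Pi.single x 1) x z
  rw [Pi.single_eq_same] at hgx hkx
  rw [Pi.single_eq_of_ne' hy] at hgy
  rw [Pi.single_eq_of_ne' hz] at hkz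
  exact ⟨⟨g * k, A.mul_mem hg hk⟩, by simp [hgx, hkx], by simp [hgy], by simp [hkz]⟩

theorem eq_of_inner_add_inner_eq (hA : A.SeparatesPoints) {x₁ x₂ x₃ : X} {c₁ c₂ c₃ : ℂ}
    (h₁ : c₁ ≠ 0) (h₂ : c₂ ≠ 0)
    (h : ∀ f : A, ⟪c₁, f.1 x₁⟫_ℝ + ⟪c₂, f.1 x₂⟫_ℝ = ⟪c₃, f.1 x₃⟫_ℝ) : x₁ = x₂ := by
  by_contra hne
  rcases eq_or_ne x₁ x₃ with rfl | hne₃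
  · obtain ⟨f, hf₂, hf₁, -⟩ := exists_apply_eq_and_eq_zero hA (Ne.symm hne) (Ne.symm hne) c₂
    have := h f
    rw [hf₁, hf₂, inner_zero_right, inner_zero_right, zero_add] at this
    exact h₂ (inner_self_eq_zero.1 this)
  · obtain ⟨f, hf₁, hf₂, hf₃⟩ := exists_apply_eq_and_eq_zero hA hne hne₃ c₁
    have := h f
    rw [hf₁, hf₂, hf₃, inner_zero_right, inner_zero_right, add_zero] at this
    exact h₁ (inner_self_eq_zero.1 this)

theorem isUnit_map_one_and_exists_algEquiv {T : A → B} (hT : Function.Bijective T)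
    {S : Set Y} (hS : ∀ g : B, (∀ y ∈ S, g.1 y = 0) → g = 0)
    (h : ∀ y ∈ S, ∃ (x : X) (a : ℂ), ∀ f : A, (T f).1 y = a * f.1 x) :
    IsUnit (T 1) ∧ ∃ Φ : A ≃ₐ[ℂ] B, ∀ f, T f = T 1 * Φ f := by
  have hext {g₁ g₂ : B} (hg : ∀ y, y ∈ S → g₁.1 y = g₂.1 y) : g₁ = g₂ :=
    sub_eq_zero.1 (hS _ fun y hy => sub_eq_zero.2 (hg y hy))
  have hadd (f g : A) : T (f + g) = T f + T g := hext fun y hy => by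
    obtain ⟨x, a, hx⟩ := h y hy
    simp [hx, mul_add]
  have hmul (f g : A) : T 1 * T (f * g) = T f * T g := hext fun y hy => by
    obtain ⟨x, a, hx⟩ := h y hy
    simp only [MulMemClass.coe_mul, ContinuousMap.mul_apply, hx, OneMemClass.coe_one,
      ContinuousMap.one_apply, mul_one]
    ring
  have hsmul (c : ℂ) (f : A) : T (c • f) = c • T f := hext fun y hy => by
    obtain ⟨x, a, hx⟩ := h y hy
    simp only [hx, SetLike.val_smul, ContinuousMap.smul_apply, smul_eq_mul]
    ring
  obtain ⟨e, he⟩ := hT.2 1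
  obtain ⟨v, hv⟩ : ∃ v, T 1 * v = 1 := ⟨T (e * e), by rw [hmul, he, one_mul]⟩
  have hu : IsUnit (T 1) := .of_mul_eq_one v hv
  let Φ : A →ₐ[ℂ] B := AlgHom.ofLinearMap
    { toFun := fun f => v * T f
      map_add' := fun f g => by rw [hadd, mul_add]
      map_smul' := fun c f => by rw [hsmul, mul_smul_comm]; rfl }
    ((mul_comm _ _).trans hv)
    fun f g => hu.mul_left_cancel (by
      change T 1 * (v * T (f * g)) = T 1 * (v * T f * (v * T g))
      linear_combination v * hmul f g - v * T f * T g * hv)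
  have hΦ (f : A) : T f = T 1 * Φ f := (by linear_combination (-T f) * hv : T f = T 1 * (v * T f))
  refine ⟨hu, .ofBijective Φ ⟨fun f g hfg => hT.1 (by rw [hΦ, hfg, ← hΦ]), fun g => ?_⟩, hΦ⟩
  obtain ⟨f, hf⟩ := hT.2 (T 1 * g)
  exact ⟨f, hu.mul_left_cancel ((hΦ f).symm.trans hf)⟩

variable [CompactSpace X] [CompactSpace Y]

theorem PeaksAt.eq_inner_of_le_norm {ℓ : A →ₗ[ℝ] ℝ} (hℓ : ∀ f, ℓ f ≤ ‖f‖) {q : A} {x : X}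
    (hq : PeaksAt q.1 x) (hℓq : ℓ q = 1) (f : A) : ℓ f = ⟪q.1 x, f.1 x⟫_ℝ := by
  have hle (g : A) : ℓ g ≤ ⟪q.1 x, g.1 x⟫_ℝ := by
    refine le_of_forall_pos_le_add fun ε hε => ?_
    obtain ⟨t, hnorm, ht : 0 < t⟩ :=
      ((hq.eventually_norm_add_smul_le g.1 hε).and self_mem_nhdsWithin).exists
    refine le_of_mul_le_mul_left ?_ ht
    have hsum := (hℓ (q + t • g)).trans hnorm
    rw [map_add, map_smul, hℓq, smul_eq_mul] at hsum
    linarith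
  refine le_antisymm (hle f) ?_
  have hneg := hle (-f)
  rw [map_neg, NegMemClass.coe_neg, ContinuousMap.neg_apply, inner_neg_right] at hneg
  linarith

theorem PeaksAt.exists_inner_map_eq (T : B →ₗᵢ[ℝ] A) {q : B} {y : Y} (hq : PeaksAt q.1 y) :
    ∃ (x : X) (c : ℂ), ‖c‖ = 1 ∧ ∀ g : B, ⟪c, (T g).1 x⟫_ℝ = ⟪q.1 y, g.1 y⟫_ℝ := by
  have hTq : ‖(T q).1‖ = 1 := (T.norm_map q).trans hq.norm_eq_one
  obtain ⟨x, hx⟩ : ∃ x, 1 ≤ ‖(T q).1 x‖ := by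
    by_contra! hlt
    exact hTq.not_lt ((ContinuousMap.norm_lt_iff _ one_pos).2 hlt)
  have hc : ‖(T q).1 x‖ = 1 := le_antisymm (hTq ▸ (T q).1.norm_coe_le_norm x) hx
  let ℓ : B →ₗ[ℝ] ℝ :=
    { toFun := fun g => ⟪(T q).1 x, (T g).1 x⟫_ℝ
      map_add' := fun f g => by rw [map_add]; exact inner_add_right _ _ _
      map_smul' := fun t f => by rw [map_smul]; exact real_inner_smul_right _ _ _ }
  refine ⟨x, (T q).1 x, hc, hq.eq_inner_of_le_norm (ℓ := ℓ) (fun g => ?_) ?_⟩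
  · calc ⟪(T q).1 x, (T g).1 x⟫_ℝ ≤ ‖(T q).1 x‖ * ‖(T g).1 x‖ := real_inner_le_norm _ _
      _ = ‖(T g).1 x‖ := by rw [hc, one_mul]
      _ ≤ ‖T g‖ := (T g).1.norm_coe_le_norm x
      _ = ‖g‖ := T.norm_map g
  · exact (real_inner_self_eq_norm_sq _).trans (by rw [hc, one_pow])

namespace IsPeakPoint

variable {y : Y}

theorem exists_inner_eq (hy : IsPeakPoint B y) (T : A ≃ₗᵢ[ℝ] B) (μ : ℂ) :
    ∃ (x : X) (c : ℂ), ‖c‖ = ‖μ‖ ∧ ∀ f : A, ⟪μ, (T f).1 y⟫_ℝ = ⟪c, f.1 x⟫_ℝ := by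
  obtain ⟨q, hq⟩ := hy
  obtain ⟨u, hu, hμ⟩ : ∃ u : ℂ, ‖u‖ = 1 ∧ μ = ‖μ‖ • u :=
    ⟨_, Complex.norm_exp_ofReal_mul_I μ.arg, (Complex.norm_mul_exp_arg_mul_I μ).symm⟩
  have hqy : q.1 y ≠ 0 := norm_ne_zero_iff.1 (hq.1 ▸ one_ne_zero)
  have hpeak : PeaksAt ((u / q.1 y) • q).1 y := hq.const_smul (by rw [norm_div, hu, hq.1, div_one])
  have hvalue : ((u / q.1 y) • q).1 y = u := div_mul_cancel₀ u hqy
  obtain ⟨x, c, hc, h⟩ := hpeak.exists_inner_map_eq T.symm.toLinearIsometry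
  refine ⟨x, ‖μ‖ • c, by rw [norm_smul, hc, norm_norm, mul_one], fun f => ?_⟩
  have hf : ⟪c, f.1 x⟫_ℝ = ⟪u, (T f).1 y⟫_ℝ := by
    simpa only [hvalue, LinearIsometryEquiv.coe_toLinearIsometry, T.symm_apply_apply] using h (T f)
  rw [real_inner_smul_left, hf, ← real_inner_smul_left, ← hμ]

theorem exists_forall_inner_eq (hy : IsPeakPoint B y) (hA : A.SeparatesPoints) (T : A ≃ₗᵢ[ℝ] B) :
    ∃ x, ∀ μ : ℂ, ∃ c : ℂ, ‖c‖ = ‖μ‖ ∧ ∀ f : A, ⟪μ, (T f).1 y⟫_ℝ = ⟪c, f.1 x⟫_ℝ := by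
  choose x c hc h using hy.exists_inner_eq T
  refine ⟨x 1, fun μ => ?_⟩
  rcases eq_or_ne μ 0 with rfl | hμ
  · exact ⟨0, rfl, fun f => by rw [inner_zero_left, inner_zero_left]⟩
  have hc_ne {ν : ℂ} (hν : ν ≠ 0) : c ν ≠ 0 := norm_ne_zero_iff.1 (hc ν ▸ norm_ne_zero_iff.2 hν)
  have hx : x 1 = x μ := eq_of_inner_add_inner_eq (c₃ := c (1 + μ)) (x₃ := x (1 + μ)) hA
    (hc_ne one_ne_zero) (hc_ne hμ) fun f => by rw [← h, ← h, ← h, inner_add_left]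
  exact ⟨c μ, hc μ, hx ▸ h μ⟩

/-- The isometry is the inverse of the adjoint of `w ↦ (T (w • 1)) y`. -/
theorem exists_map_apply_eq (hy : IsPeakPoint B y) (hA : A.SeparatesPoints) (T : A ≃ₗᵢ[ℝ] B) :
    ∃ (x : X) (M : ℂ ≃ₗᵢ[ℝ] ℂ), ∀ f : A, (T f).1 y = M (f.1 x) := by
  obtain ⟨x, hx⟩ := hy.exists_forall_inner_eq hA T
  let L : ℂ →ₗ[ℝ] ℂ :=
    { toFun := fun w => (T (w • 1)).1 y
      map_add' := fun v w => by rw [add_smul, map_add]; rfl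
      map_smul' := fun t w => by rw [smul_assoc, map_smul]; rfl }
  have hT (μ : ℂ) : ‖L.adjoint μ‖ = ‖μ‖ ∧
      ∀ f : A, ⟪μ, (T f).1 y⟫_ℝ = ⟪L.adjoint μ, f.1 x⟫_ℝ := by
    obtain ⟨c, hc, h⟩ := hx μ
    have hadj : L.adjoint μ = c := ext_inner_right ℝ fun w => by
      rw [LinearMap.adjoint_inner_left]
      exact (h (w • 1)).trans (congrArg _ (mul_one w))
    exact hadj ▸ ⟨hc, h⟩
  let M : ℂ ≃ₗᵢ[ℝ] ℂ := LinearIsometry.toLinearIsometryEquiv ⟨L.adjoint, fun μ => (hT μ).1⟩ rfl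
  refine ⟨x, M.symm, fun f => ext_inner_left ℝ fun μ => ?_⟩
  calc ⟪μ, (T f).1 y⟫_ℝ = ⟪M μ, f.1 x⟫_ℝ := (hT μ).2 f
    _ = ⟪μ, M.symm (f.1 x)⟫_ℝ := by rw [← M.inner_map_map μ, M.apply_symm_apply]

theorem exists_map_apply_eq_mul (hy : IsPeakPoint B y) (hA : A.SeparatesPoints)
    (T : A ≃ₗᵢ[ℝ] B) :
    ∃ (x : X) (a : Circle), (∀ f : A, (T f).1 y = a * f.1 x) ∨
      ∀ f : A, (T f).1 y = a * conj (f.1 x) := by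
  obtain ⟨x, M, hM⟩ := hy.exists_map_apply_eq hA T
  obtain ⟨a, rfl | rfl⟩ := linear_isometry_complex M
  exacts [⟨x, a, Or.inl hM⟩, ⟨x, a, Or.inr hM⟩]

end IsPeakPoint

/-- The product `(T i - I • T 1) * (T i + I • T 1)` vanishes at every peak point: the first factor
where `T` is linear, the second where it is antilinear. -/
theorem forall_eq_mul_or_forall_eq_mul_conj [NoZeroDivisors B] (hA : A.SeparatesPoints)
    (T : A ≃ₗᵢ[ℝ] B) {S : Set Y} (hS : ∀ g : B, (∀ y ∈ S, g.1 y = 0) → g = 0)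
    (hpeak : ∀ y ∈ S, IsPeakPoint B y) :
    (∀ y ∈ S, ∃ (x : X) (a : Circle), ∀ f : A, (T f).1 y = a * f.1 x) ∨
      ∀ y ∈ S, ∃ (x : X) (a : Circle), ∀ f : A, (T f).1 y = a * conj (f.1 x) := by
  have hlin {x : X} {y : Y} {a : Circle} (h : ∀ f : A, (T f).1 y = a * f.1 x) :
      (T (Complex.I • 1)).1 y = Complex.I * a ∧ (T 1).1 y = a := by
    rw [h, h]
    simp [mul_comm]
  have hanti {x : X} {y : Y} {a : Circle} (h : ∀ f : A, (T f).1 y = a * conj (f.1 x)) :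
      (T (Complex.I • 1)).1 y = -(Complex.I * a) ∧ (T 1).1 y = a := by
    rw [h, h]
    simp [mul_comm]
  have hprod : (T (Complex.I • 1) - Complex.I • T 1) * (T (Complex.I • 1) + Complex.I • T 1) = 0 :=
    hS _ fun y hy => by
      obtain ⟨x, a, h | h⟩ := (hpeak y hy).exists_map_apply_eq_mul hA T
      · simp [hlin h]
      · simp [hanti h]
  refine (mul_eq_zero.1 hprod).imp (fun h₀ y hy => ?_) (fun h₀ y hy => ?_) <;>
    obtain ⟨x, a, h | h⟩ := (hpeak y hy).exists_map_apply_eq_mul hA T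
  · exact ⟨x, a, h⟩
  · have hfactor : -(2 * Complex.I * a) = (T (Complex.I • 1) - Complex.I • T 1).1 y := by
      simp only [AddSubgroupClass.coe_sub, SetLike.val_smul, ContinuousMap.sub_apply, hanti h,
        ContinuousMap.smul_apply, smul_eq_mul]
      ring
    rw [h₀] at hfactor
    simp at hfactor
  · have hfactor : 2 * Complex.I * a = (T (Complex.I • 1) + Complex.I • T 1).1 y := by
      simp only [AddMemClass.coe_add, SetLike.val_smul, ContinuousMap.add_apply, hlin h,
        ContinuousMap.smul_apply, smul_eq_mul]
      ring
    rw [h₀] at hfactor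
    simp at hfactor
  · exact ⟨x, a, h⟩

end FunctionAlgebras

namespace diskAlgebra

/-- The element of the disk algebra given by a function on `ℂ` that is holomorphic on the open disk
and continuous on its closure. -/
def ofDiffContOnCl (F : ℂ → ℂ) (hF : DiffContOnCl ℂ F (ball 0 1)) : diskAlgebra :=
  ⟨⟨fun z => F z, hF.continuousOn_ball.domRestrict⟩, F, hF.differentiableOn, fun _ => rfl⟩

@[simp]
theorem ofDiffContOnCl_apply {F : ℂ → ℂ} (hF : DiffContOnCl ℂ F (ball 0 1)) (z : ClosedDisk) :
    (ofDiffContOnCl F hF).1 z = F z :=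
  rfl

/-- The coordinate function `z ↦ z` as an element of the disk algebra. -/
def coord : diskAlgebra :=
  ofDiffContOnCl id differentiable_id.diffContOnCl

@[simp]
theorem coord_apply (z : ClosedDisk) : coord.1 z = z :=
  rfl

theorem ext {f g : diskAlgebra} (h : ∀ z, f.1 z = g.1 z) : f = g :=
  Subtype.ext (ContinuousMap.ext h)

theorem separatesPoints : diskAlgebra.SeparatesPoints := fun _ _ hne =>
  ⟨coord.1, ⟨coord.1, coord.2, rfl⟩, Subtype.coe_ne_coe.2 hne⟩

theorem exists_diffContOnCl (f : diskAlgebra) :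
    ∃ F : ℂ → ℂ, DiffContOnCl ℂ F (ball 0 1) ∧ ∀ z : ClosedDisk, f.1 z = F z := by
  obtain ⟨F, hF, hf⟩ := f.2
  refine ⟨F, ⟨hF, ?_⟩, hf⟩
  rw [closure_ball _ one_ne_zero, continuousOn_iff_continuous_domRestrict]
  exact f.1.continuous.congr hf

instance : Nontrivial ClosedDisk :=
  ⟨0, 1, fun h => zero_ne_one (congrArg Subtype.val h)⟩

theorem dense_norm_lt_one : Dense {z : ClosedDisk | ‖(z : ℂ)‖ < 1} := by
  refine Subtype.dense_iff.2 ((closure_ball (0 : ℂ) one_ne_zero).ge.trans (closure_mono ?_))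
  exact fun z hz => ⟨⟨z, ball_subset_closedBall hz⟩, mem_ball_zero_iff.1 hz, rfl⟩

section MaximumPrinciple

theorem exists_norm_apply_eq_norm (f : diskAlgebra) :
    ∃ y : ClosedDisk, ‖(y : ℂ)‖ = 1 ∧ ‖f.1 y‖ = ‖f‖ := by
  obtain ⟨F, hF, hf⟩ := exists_diffContOnCl f
  obtain ⟨y, hy, hmax⟩ := Complex.exists_mem_frontier_isMaxOn_norm isBounded_ball
    ⟨0, mem_ball_self one_pos⟩ hF
  rw [frontier_ball _ one_ne_zero, mem_sphere_zero_iff_norm] at hy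
  refine ⟨⟨y, mem_closedBall_zero_iff.2 hy.le⟩, hy, le_antisymm (f.1.norm_coe_le_norm _) ?_⟩
  refine (ContinuousMap.norm_le f.1 (norm_nonneg _)).2 fun z => ?_
  rw [hf, hf]
  exact hmax (by rw [closure_ball _ one_ne_zero]; exact z.2)

theorem norm_apply_le_of_forall_circle {f : diskAlgebra} {C : ℝ}
    (h : ∀ y : ClosedDisk, ‖(y : ℂ)‖ = 1 → ‖f.1 y‖ ≤ C) (z : ClosedDisk) : ‖f.1 z‖ ≤ C := by
  obtain ⟨y, hy, hfy⟩ := exists_norm_apply_eq_norm f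
  exact (f.1.norm_coe_le_norm z).trans (hfy.symm.trans_le (h y hy))

theorem eq_zero_of_forall_circle {f : diskAlgebra}
    (h : ∀ y : ClosedDisk, ‖(y : ℂ)‖ = 1 → f.1 y = 0) : f = 0 :=
  ext fun z => norm_le_zero_iff.1 <|
    norm_apply_le_of_forall_circle (fun y hy => (norm_eq_zero.2 (h y hy)).le) z

theorem norm_apply_lt_of_apply_ne {f : diskAlgebra} {C : ℝ} (hC : ∀ z, ‖f.1 z‖ ≤ C)
    {x y : ClosedDisk} (hne : f.1 x ≠ f.1 y) {z : ClosedDisk} (hz : ‖(z : ℂ)‖ < 1) :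
    ‖f.1 z‖ < C := by
  obtain ⟨F, hF, hf⟩ := exists_diffContOnCl f
  refine (hC z).lt_of_ne fun hz_max => hne ?_
  have hmax : IsMaxOn (norm ∘ F) (ball 0 1) z := fun w hw => by
    have := hC ⟨w, ball_subset_closedBall hw⟩
    rwa [← hz_max, hf, hf] at this
  have hconst (w : ClosedDisk) : f.1 w = F z := by
    rw [hf]
    refine Complex.eqOn_closure_of_isPreconnected_of_isMaxOn_norm
      (convex_ball (0 : ℂ) 1).isPreconnected isOpen_ball hF (mem_ball_zero_iff.2 hz) hmax ?_
    rw [closure_ball _ one_ne_zero]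
    exact w.2
  rw [hconst, hconst]

theorem norm_lt_one_of_apply_eq_coe {h : diskAlgebra} {φ : ClosedDisk → ClosedDisk}
    (hφ : ∀ z, h.1 z = φ z) {x y : ClosedDisk} (hne : φ x ≠ φ y) {z : ClosedDisk}
    (hz : ‖(z : ℂ)‖ < 1) : ‖(φ z : ℂ)‖ < 1 := by
  rw [← hφ]
  refine norm_apply_lt_of_apply_ne (fun w => ?_) (x := x) (y := y) ?_ hz
  · rw [hφ]
    exact mem_closedBall_zero_iff.1 (φ w).2
  · rw [hφ, hφ]
    exact Subtype.coe_ne_coe.2 hne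

theorem exists_forall_apply_eq_comp {h : diskAlgebra} {φ : ClosedDisk → ClosedDisk}
    (hφ : ∀ z, h.1 z = φ z) {x y : ClosedDisk} (hne : φ x ≠ φ y) (f : diskAlgebra) :
    ∃ g : diskAlgebra, ∀ z, g.1 z = f.1 (φ z) := by
  obtain ⟨F, hF, hf⟩ := exists_diffContOnCl f
  obtain ⟨H, hH, hh⟩ := exists_diffContOnCl h
  have hHφ (z : ClosedDisk) : H z = φ z := (hh z).symm.trans (hφ z)
  have hmaps : Set.MapsTo H (ball 0 1) (ball 0 1) := fun z hz => by
    rw [hHφ ⟨z, ball_subset_closedBall hz⟩, mem_ball_zero_iff]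
    exact norm_lt_one_of_apply_eq_coe hφ hne (mem_ball_zero_iff.1 hz)
  exact ⟨ofDiffContOnCl _ (hF.comp hH hmaps), fun z => by simp [hf, hHφ]⟩

end MaximumPrinciple

theorem isPeakPoint_of_norm_eq_one {x : ClosedDisk} (hx : ‖(x : ℂ)‖ = 1) :
    IsPeakPoint diskAlgebra x := by
  have hq (z : ClosedDisk) :
      ((1 / 2 : ℝ) • (algebraMap ℂ diskAlgebra x + coord)).1 z = (1 / 2 : ℝ) • (x + z : ℂ) := rfl
  refine ⟨(1 / 2 : ℝ) • (algebraMap ℂ diskAlgebra x + coord), ?_, fun z hz => ?_⟩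
  · rw [hq, ← two_smul ℝ (x : ℂ), smul_smul, norm_smul, hx]
    norm_num
  · rw [hq, smul_add, ← mem_ball_zero_iff]
    exact combo_mem_ball_of_ne x.2 z.2 (Subtype.coe_ne_coe.2 hz.symm) (by norm_num) (by norm_num)
      (by norm_num)

section Divisibility

instance : NoZeroDivisors diskAlgebra where
  eq_zero_or_eq_zero_of_mul_eq_zero {f g} hfg := by
    obtain ⟨F, hF, hf⟩ := exists_diffContOnCl f
    obtain ⟨G, hG, hg⟩ := exists_diffContOnCl g
    have hFG : ∀ z ∈ ball (0 : ℂ) 1, F z * G z = 0 := fun z hz => by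
      have hz' := congrArg (fun k : diskAlgebra => k.1 ⟨z, ball_subset_closedBall hz⟩) hfg
      simpa [hf, hg] using hz'
    have eq_zero {k : diskAlgebra} {K : ℂ → ℂ} (hk : ∀ z : ClosedDisk, k.1 z = K z)
        (hK : ∀ z ∈ ball (0 : ℂ) 1, K z = 0) : k = 0 :=
      ext <| congrFun <| k.1.continuous.ext_on dense_norm_lt_one continuous_const fun z hz =>
        (hk z).trans (hK z (mem_ball_zero_iff.2 hz))
    exact (AnalyticOnNhd.eq_zero_or_eq_zero_of_mul_eq_zero
      (hF.differentiableOn.analyticOnNhd isOpen_ball)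
      (hG.differentiableOn.analyticOnNhd isOpen_ball) hFG
      (convex_ball (0 : ℂ) 1).isPreconnected).imp (eq_zero hf) (eq_zero hg)

instance : IsDomain diskAlgebra :=
  NoZeroDivisors.to_isDomain _

theorem isUnit_iff {f : diskAlgebra} : IsUnit f ↔ ∀ z, f.1 z ≠ 0 := by
  refine ⟨fun hf z => ?_, fun h => ?_⟩
  · exact (hf.map ((ContinuousMap.evalAlgHom ℂ ℂ z).comp diskAlgebra.val)).ne_zero
  · obtain ⟨F, hF, hf⟩ := exists_diffContOnCl f
    have hF₀ (z : ℂ) (hz : z ∈ closure (ball 0 1)) : F z ≠ 0 := by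
      rw [closure_ball _ one_ne_zero] at hz
      exact hf ⟨z, hz⟩ ▸ h ⟨z, hz⟩
    refine .of_mul_eq_one (ofDiffContOnCl _ (hF.inv hF₀)) (ext fun z => ?_)
    simp [← hf, h z]

theorem coord_sub_algebraMap_dvd {f : diskAlgebra} {w : ClosedDisk} (hw : ‖(w : ℂ)‖ < 1)
    (hf : f.1 w = 0) : coord - algebraMap ℂ diskAlgebra w ∣ f := by
  obtain ⟨F, hF, hfF⟩ := exists_diffContOnCl f
  have hball : ball (0 : ℂ) 1 ∈ nhds (w : ℂ) := isOpen_ball.mem_nhds (mem_ball_zero_iff.2 hw)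
  have hslope : DiffContOnCl ℂ (dslope F w) (ball 0 1) :=
    ⟨(Complex.differentiableOn_dslope hball).2 hF.differentiableOn,
      (continuousOn_dslope (Filter.mem_of_superset hball subset_closure)).2
        ⟨hF.continuousOn, hF.differentiableOn.differentiableAt hball⟩⟩
  refine ⟨ofDiffContOnCl _ hslope, ext fun z => ?_⟩
  calc f.1 z = F z - F w := by rw [← hfF, ← hfF, hf, sub_zero]
    _ = (z - w) * dslope F w z := (sub_smul_dslope F (w : ℂ) z).symm

theorem exists_eq_algebraMap_of_isUnit {u : diskAlgebra} (hu : IsUnit u)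
    (hcircle : ∀ y : ClosedDisk, ‖(y : ℂ)‖ = 1 → ‖u.1 y‖ = 1) :
    ∃ c : ℂ, ‖c‖ = 1 ∧ u = algebraMap ℂ diskAlgebra c := by
  obtain ⟨v, huv⟩ := hu.exists_right_inv
  have hmul (z : ClosedDisk) : ‖u.1 z‖ * ‖v.1 z‖ = 1 := by
    rw [← norm_mul, ← ContinuousMap.mul_apply]
    simpa using congrArg (fun f : diskAlgebra => ‖f.1 z‖) huv
  have hu_le := norm_apply_le_of_forall_circle fun y hy => (hcircle y hy).le
  have hv_le := norm_apply_le_of_forall_circle (f := v) (C := 1) fun y hy => by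
    simpa only [hcircle y hy, one_mul] using (hmul y).le
  have hu_zero : ‖u.1 0‖ = 1 := (hu_le 0).antisymm <| calc
    1 = ‖u.1 0‖ * ‖v.1 0‖ := (hmul 0).symm
    _ ≤ ‖u.1 0‖ := mul_le_of_le_one_right (norm_nonneg _) (hv_le 0)
  refine ⟨u.1 0, hu_zero, ext fun z => ?_⟩
  by_contra hne
  exact (norm_apply_lt_of_apply_ne hu_le hne (z := 0) (by simp)).ne hu_zero

end Divisibility

section Automorphisms

theorem exists_apply_eq_map_apply (Φ : diskAlgebra →ₐ[ℂ] diskAlgebra) (f : diskAlgebra)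
    (z : ClosedDisk) : ∃ w, f.1 w = (Φ f).1 z := by
  by_contra! hne
  have hunit : IsUnit (f - algebraMap ℂ diskAlgebra ((Φ f).1 z)) :=
    isUnit_iff.2 fun w => sub_ne_zero.2 (hne w)
  refine isUnit_iff.1 (hunit.map Φ) z ?_
  rw [map_sub, AlgHom.commutes]
  exact sub_self _

/-- If `φ z` is in the open disk, then `coord - φ z` divides `f - f (φ z)`, so `Φ f - f (φ z)`
vanishes at `z` because `Φ coord - φ z` does. The boundary is then reached by continuity. -/
theorem exists_forall_map_apply_eq_apply (Φ : diskAlgebra →ₐ[ℂ] diskAlgebra)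
    (hΦ : Function.Injective Φ) :
    ∃ φ : ClosedDisk → ClosedDisk, ∀ f z, (Φ f).1 z = f.1 (φ z) := by
  choose φ hφ using exists_apply_eq_map_apply Φ coord
  have hφ_cont : Continuous φ := continuous_induced_rng.2 ((Φ coord).1.continuous.congr
    fun z => (hφ z).symm)
  obtain ⟨x, y, hne⟩ : ∃ x y, φ x ≠ φ y := by
    by_contra! hconst
    have hcoord : coord = algebraMap ℂ diskAlgebra (φ 0) := hΦ <| ext fun z => by
      rw [← hφ, hconst z 0, AlgHom.commutes]
      rfl
    have hval (z : ClosedDisk) : (z : ℂ) = φ 0 := congrArg (fun f : diskAlgebra => f.1 z) hcoord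
    exact zero_ne_one ((hval 0).trans (hval 1).symm)
  refine ⟨φ, fun f => congrFun <| (Φ f).1.continuous.ext_on dense_norm_lt_one
    (f.1.continuous.comp hφ_cont) fun z hz => ?_⟩
  have hφz := norm_lt_one_of_apply_eq_coe (fun w => (hφ w).symm) hne hz
  have hdvd : coord - algebraMap ℂ diskAlgebra (φ z) ∣ f - algebraMap ℂ diskAlgebra (f.1 (φ z)) :=
    coord_sub_algebraMap_dvd hφz (sub_self _)
  obtain ⟨g, hg⟩ := map_dvd Φ hdvd
  rw [map_sub, map_sub, AlgHom.commutes, AlgHom.commutes] at hg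
  have hz_eq := congrArg (fun k : diskAlgebra => k.1 z) hg
  simpa [← hφ, sub_eq_zero] using hz_eq

theorem norm_one_sub_conj_mul {w y : ℂ} (hy : ‖y‖ = 1) : ‖1 - conj w * y‖ = ‖y - w‖ := by
  have h : conj (1 - conj w * y) * y = y - w := by
    rw [map_sub, map_one, map_mul, Complex.conj_conj, sub_mul, one_mul, mul_assoc,
      Complex.conj_mul', hy, Complex.ofReal_one, one_pow, mul_one]
  rw [← h, norm_mul, RCLike.norm_conj, hy, mul_one]

theorem one_sub_conj_mul_ne_zero {w z : ℂ} (hw : ‖w‖ < 1) (hz : ‖z‖ ≤ 1) :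
    1 - conj w * z ≠ 0 := by
  refine sub_ne_zero.2 fun h => (?_ : ‖conj w * z‖ < 1).ne (by rw [← h, norm_one])
  rw [norm_mul, RCLike.norm_conj]
  exact mul_lt_one_of_nonneg_of_lt_one_left (norm_nonneg _) hw hz

theorem exists_mul_one_sub_conj_eq {h : diskAlgebra} {w : ClosedDisk} (hw : ‖(w : ℂ)‖ < 1)
    (hcircle : ∀ y : ClosedDisk, ‖(y : ℂ)‖ = 1 → ‖h.1 y‖ = 1)
    (hassoc : Associated (coord - algebraMap ℂ diskAlgebra w) h) :
    ∃ c : ℂ, ‖c‖ = 1 ∧ ∀ z : ClosedDisk, h.1 z * (1 - conj (w : ℂ) * z) = c * (z - w) := by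
  obtain ⟨u, rfl⟩ := hassoc
  have hden : IsUnit (1 - conj (w : ℂ) • coord) :=
    isUnit_iff.2 fun z => one_sub_conj_mul_ne_zero hw (mem_closedBall_zero_iff.1 z.2)
  obtain ⟨c, hc, huc⟩ := exists_eq_algebraMap_of_isUnit (u.isUnit.mul hden) fun y hy => calc
    ‖(u.1 * (1 - conj (w : ℂ) • coord)).1 y‖ = ‖u.1.1 y‖ * ‖1 - conj (w : ℂ) * y‖ := norm_mul _ _
    _ = ‖(y : ℂ) - w‖ * ‖u.1.1 y‖ := by rw [norm_one_sub_conj_mul hy, mul_comm]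
    _ = 1 := (norm_mul _ _).symm.trans (hcircle y hy)
  refine ⟨c, hc, fun z => ?_⟩
  have hz : u.1.1 z * (1 - conj (w : ℂ) * z) = c := congrArg (fun k : diskAlgebra => k.1 z) huc
  change (z - w : ℂ) * u.1.1 z * (1 - conj (w : ℂ) * z) = c * (z - w)
  rw [← hz]
  ring

theorem isMobiusOfDisk_of_mul_one_sub_conj_eq {φ : ClosedDisk → ClosedDisk}
    (hφ : Function.Surjective φ) {w c : ℂ} (hw : ‖w‖ < 1) (hc : c ≠ 0)
    (h : ∀ z : ClosedDisk, φ z * (1 - conj w * z) = c * (z - w)) : IsMobiusOfDisk φ := by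
  refine ⟨hφ, c, -(c * w), -conj w, 1, ?_, fun z => ?_⟩
  · convert mul_ne_zero hc (one_sub_conj_mul_ne_zero hw hw.le) using 1
    ring
  · have hden : -conj w * z + 1 = 1 - conj w * z := by ring
    have hne := one_sub_conj_mul_ne_zero hw (mem_closedBall_zero_iff.1 z.2)
    rw [hden, eq_div_iff hne, h]
    exact ⟨hne, by ring⟩

theorem exists_isMobiusOfDisk_forall_map_apply_eq (Φ : diskAlgebra ≃ₐ[ℂ] diskAlgebra) :
    ∃ φ, IsMobiusOfDisk φ ∧ ∀ f z, (Φ f).1 z = f.1 (φ z) := by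
  obtain ⟨φ, hφ⟩ := exists_forall_map_apply_eq_apply Φ.toAlgHom Φ.injective
  obtain ⟨ψ, hψ⟩ := exists_forall_map_apply_eq_apply Φ.symm.toAlgHom Φ.symm.injective
  change ∀ f z, (Φ f).1 z = f.1 (φ z) at hφ
  change ∀ f z, (Φ.symm f).1 z = f.1 (ψ z) at hψ
  have hψφ : Function.LeftInverse ψ φ := fun z => Subtype.ext <| by
    rw [← coord_apply, ← hψ, ← hφ, Φ.apply_symm_apply, coord_apply]
  have hφψ : Function.LeftInverse φ ψ := fun z => Subtype.ext <| by
    rw [← coord_apply, ← hφ, ← hψ, Φ.symm_apply_apply, coord_apply]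
  obtain ⟨x, y, hxy⟩ := exists_pair_ne ClosedDisk
  have hψ_lt {z : ClosedDisk} (hz : ‖(z : ℂ)‖ < 1) : ‖(ψ z : ℂ)‖ < 1 :=
    norm_lt_one_of_apply_eq_coe (hψ coord) (hφψ.injective.ne hxy) hz
  have hcircle (y : ClosedDisk) (hy : ‖(y : ℂ)‖ = 1) : ‖(Φ coord).1 y‖ = 1 := by
    rw [hφ]
    refine (mem_closedBall_zero_iff.1 (φ y).2).antisymm (not_lt.1 fun hlt => ?_)
    exact (hψ_lt hlt).ne (by rw [hψφ, hy])
  have hw : ‖(ψ 0 : ℂ)‖ < 1 := hψ_lt (by simp)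
  have hassoc : Associated (coord - algebraMap ℂ diskAlgebra (ψ 0)) (Φ coord) := by
    refine associated_of_dvd_dvd (coord_sub_algebraMap_dvd hw ?_) ?_
    · rw [hφ, hφψ]
      simp
    · have hdvd : coord - algebraMap ℂ diskAlgebra ((0 : ClosedDisk) : ℂ) ∣
          Φ.symm coord - algebraMap ℂ diskAlgebra (ψ 0) :=
        coord_sub_algebraMap_dvd (by simp) (sub_eq_zero.2 (hψ coord 0))
      simpa using map_dvd Φ hdvd
  obtain ⟨c, hc, h⟩ := exists_mul_one_sub_conj_eq hw hcircle hassoc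
  refine ⟨φ, isMobiusOfDisk_of_mul_one_sub_conj_eq (c := c) hφψ.surjective hw ?_ fun z => ?_, hφ⟩
  · exact norm_ne_zero_iff.1 (hc ▸ one_ne_zero)
  · rw [← h, hφ, coord_apply]

end Automorphisms

section Conjugation

theorem conjDisk_involutive : Function.Involutive conjDisk := fun z =>
  Subtype.ext (Complex.conj_conj (z : ℂ))

/-- The element `z ↦ conj (f (conj z))` of the disk algebra, whose Taylor coefficients at `0` are
the conjugates of those of `f`. -/
noncomputable def conjugate (f : diskAlgebra) : diskAlgebra where
  val := ⟨fun z => conj (f.1 (conjDisk z)), Complex.continuous_conj.comp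
    (f.1.continuous.comp ((Complex.continuous_conj.comp continuous_subtype_val).subtype_mk _))⟩
  property := by
    obtain ⟨F, hF, hf⟩ := f.2
    refine ⟨conj ∘ F ∘ conj, fun z hz => ?_, fun z => congrArg conj (hf (conjDisk z))⟩
    have hz_conj : conj z ∈ ball (0 : ℂ) 1 := by simpa using hz
    have hdiff := (hF.differentiableAt (isOpen_ball.mem_nhds hz_conj)).conj_conj
    rw [Complex.conj_conj] at hdiff
    exact hdiff.differentiableWithinAt

@[simp]
theorem conjugate_apply (f : diskAlgebra) (z : ClosedDisk) :
    (conjugate f).1 z = conj (f.1 (conjDisk z)) :=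
  rfl

theorem conjugate_involutive : Function.Involutive conjugate := fun f =>
  ext fun z => by rw [conjugate_apply, conjugate_apply, Complex.conj_conj, conjDisk_involutive]

/-- The conjugation `conjugate` of the disk algebra as a real-linear isometry. -/
noncomputable def conjIsometry : diskAlgebra ≃ₗᵢ[ℝ] diskAlgebra where
  toLinearEquiv := .ofInvolutive
    { toFun := conjugate
      map_add' := fun _ _ => ext fun _ => map_add conj _ _
      map_smul' := fun t f => ext fun z => by
        change conj (t * f.1 (conjDisk z)) = t * conj (f.1 (conjDisk z))
        rw [map_mul, Complex.conj_ofReal] }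
    conjugate_involutive
  norm_map' f := norm_eq_norm_of_surjective (f := f.1) conjDisk_involutive.surjective
    fun _ => RCLike.norm_conj _

theorem conjIsometry_apply_apply (f : diskAlgebra) (z : ClosedDisk) :
    (conjIsometry f).1 z = conj (f.1 (conjDisk z)) :=
  rfl

theorem conjIsometry_conjIsometry (f : diskAlgebra) : conjIsometry (conjIsometry f) = f :=
  conjugate_involutive f

end Conjugation

end diskAlgebra

namespace IsMobiusOfDisk

open diskAlgebra

variable {φ : ClosedDisk → ClosedDisk}

theorem exists_coe_eq (hφ : IsMobiusOfDisk φ) : ∃ h : diskAlgebra, ∀ z, h.1 z = φ z := by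
  obtain ⟨-, a, b, c, d, -, h⟩ := hφ
  have hden (z : ℂ) (hz : z ∈ closedBall 0 1) : c * z + d ≠ 0 := (h ⟨z, hz⟩).1
  have hdiff : DifferentiableOn ℂ (fun z => (a * z + b) / (c * z + d)) (closedBall 0 1) :=
    .div (by fun_prop) (by fun_prop) hden
  rw [← closure_ball _ one_ne_zero] at hdiff
  exact ⟨ofDiffContOnCl _ hdiff.diffContOnCl, fun z => (h z).2.symm⟩

theorem exists_forall_apply_eq (hφ : IsMobiusOfDisk φ) (f : diskAlgebra) :
    ∃ g : diskAlgebra, ∀ z, g.1 z = f.1 (φ z) := by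
  obtain ⟨h, hh⟩ := hφ.exists_coe_eq
  obtain ⟨v, w, hvw⟩ := exists_pair_ne ClosedDisk
  obtain ⟨x, rfl⟩ := hφ.1 v
  obtain ⟨y, rfl⟩ := hφ.1 w
  exact exists_forall_apply_eq_comp hh hvw f

theorem injective (hφ : IsMobiusOfDisk φ) : Function.Injective φ := by
  obtain ⟨-, a, b, c, d, hdet, h⟩ := hφ
  intro z w hzw
  have hval := congrArg Subtype.val hzw
  rw [(h z).2, (h w).2, div_eq_div_iff (h z).1 (h w).1] at hval
  refine Subtype.ext (mul_left_cancel₀ hdet ?_)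
  linear_combination hval

theorem exists_leftInverse (hφ : IsMobiusOfDisk φ) :
    ∃ ψ, IsMobiusOfDisk ψ ∧ Function.LeftInverse ψ φ := by
  obtain ⟨ψ, hψφ, -⟩ := Function.bijective_iff_has_inverse.1 ⟨hφ.injective, hφ.1⟩
  obtain ⟨hsurj, a, b, c, d, hdet, h⟩ := hφ
  refine ⟨ψ, ⟨hψφ.surjective, d, -b, -c, a, ?_, hsurj.forall.2 fun z => ?_⟩, hψφ⟩
  · convert hdet using 1
    ring
  have hz : (φ z : ℂ) * (c * z + d) = a * z + b := by rw [(h z).2, div_mul_cancel₀ _ (h z).1]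
  have hden : -c * (φ z : ℂ) + a ≠ 0 := fun h₀ => hdet (by
    linear_combination (c * (z : ℂ) + d) * h₀ + c * hz)
  refine ⟨hden, ?_⟩
  rw [hψφ z, eq_div_iff hden]
  linear_combination -hz

theorem exists_linearIsometryEquiv (hφ : IsMobiusOfDisk φ) :
    ∃ C : diskAlgebra ≃ₗᵢ[ℂ] diskAlgebra, ∀ f z, (C f).1 z = f.1 (φ z) := by
  choose C hC using hφ.exists_forall_apply_eq
  obtain ⟨ψ, hψ, hψφ⟩ := hφ.exists_leftInverse
  let L : diskAlgebra →ₗᵢ[ℂ] diskAlgebra :=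
    { toFun := C
      map_add' := fun f g => ext fun z => by
        rw [hC]
        exact (congrArg₂ (· + ·) (hC f z) (hC g z)).symm
      map_smul' := fun c f => ext fun z => by
        rw [hC]
        exact (congrArg (fun w => c * w) (hC f z)).symm
      norm_map' := fun f => norm_eq_norm_of_surjective hφ.1 fun z => congrArg norm (hC f z) }
  refine ⟨.ofSurjective L fun g => ?_, hC⟩
  obtain ⟨f, hf⟩ := hψ.exists_forall_apply_eq g
  refine ⟨f, ext fun z => (hC f z).trans ?_⟩
  rw [hf, hψφ]

theorem exists_linearIsometryEquiv_conj (hφ : IsMobiusOfDisk φ) :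
    ∃ C : diskAlgebra ≃ₗᵢ[ℝ] diskAlgebra, ∀ f z, (C f).1 z = conj (f.1 (conjDisk (φ z))) := by
  obtain ⟨C, hC⟩ := hφ.exists_linearIsometryEquiv
  exact ⟨conjIsometry.trans { C with toLinearEquiv := C.toLinearEquiv.restrictScalars ℝ },
    fun f => hC (conjIsometry f)⟩

end IsMobiusOfDisk

namespace diskAlgebra

section Classification

theorem exists_isMobiusOfDisk_forall_map_apply_eq_mul {T : diskAlgebra → diskAlgebra}
    (hT : Function.Bijective T) (h : ∀ y : ClosedDisk, ‖(y : ℂ)‖ = 1 →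
      ∃ (x : ClosedDisk) (a : Circle), ∀ f : diskAlgebra, (T f).1 y = a * f.1 x) :
    ∃ (φ : ClosedDisk → ClosedDisk) (α : ℂ), IsMobiusOfDisk φ ∧ ‖α‖ = 1 ∧
      ∀ f z, (T f).1 z = α * f.1 (φ z) := by
  obtain ⟨hunit, Φ, hΦ⟩ := isUnit_map_one_and_exists_algEquiv hT
    (S := {y : ClosedDisk | ‖(y : ℂ)‖ = 1}) (fun _ => eq_zero_of_forall_circle)
    fun y hy => (h y hy).imp fun _ ⟨a, ha⟩ => ⟨a, ha⟩
  obtain ⟨α, hα, hTα⟩ := exists_eq_algebraMap_of_isUnit hunit fun y hy => by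
    obtain ⟨x, a, ha⟩ := h y hy
    rw [ha, norm_mul, Circle.norm_coe, one_mul]
    exact norm_one
  obtain ⟨φ, hφ, hcomp⟩ := exists_isMobiusOfDisk_forall_map_apply_eq Φ
  refine ⟨φ, α, hφ, hα, fun f z => ?_⟩
  rw [hΦ, hTα, ← hcomp]
  rfl

theorem exists_isMobiusOfDisk_of_linearIsometryEquiv (T : diskAlgebra ≃ₗᵢ[ℝ] diskAlgebra) :
    ∃ (φ : ClosedDisk → ClosedDisk) (α : ℂ), IsMobiusOfDisk φ ∧ ‖α‖ = 1 ∧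
      ((∀ f z, (T f).1 z = α * f.1 (φ z)) ∨
        ∀ f z, (T f).1 z = α * conj (f.1 (conjDisk (φ z)))) := by
  rcases forall_eq_mul_or_forall_eq_mul_conj separatesPoints T
    (S := {y : ClosedDisk | ‖(y : ℂ)‖ = 1}) (fun _ => eq_zero_of_forall_circle)
    (fun _ => isPeakPoint_of_norm_eq_one) with h | h
  · obtain ⟨φ, α, hφ, hα, hT⟩ := exists_isMobiusOfDisk_forall_map_apply_eq_mul T.bijective h
    exact ⟨φ, α, hφ, hα, .inl hT⟩
  · obtain ⟨φ, α, hφ, hα, hT⟩ := exists_isMobiusOfDisk_forall_map_apply_eq_mul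
      (conjIsometry.trans T).bijective fun y hy => by
        obtain ⟨x, a, ha⟩ := h y hy
        refine ⟨conjDisk x, a, fun f => ?_⟩
        rw [LinearIsometryEquiv.trans_apply, ha, conjIsometry_apply_apply, Complex.conj_conj]
    refine ⟨φ, α, hφ, hα, .inr fun f z => ?_⟩
    rw [← conjIsometry_apply_apply, ← hT, LinearIsometryEquiv.trans_apply,
      conjIsometry_conjIsometry]

end Classification

end diskAlgebra

theorem mainTheorem11 :
    -- a self-map of the disk algebra is a surjective isometry iff it has one of the two forms
    (∀ U : diskAlgebra → diskAlgebra,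
      (Isometry U ∧ Function.Surjective U) ↔
        ∃ (φ : ClosedDisk → ClosedDisk) (α : ℂ), IsMobiusOfDisk φ ∧ ‖α‖ = 1 ∧
          ((∀ (f : diskAlgebra) (z : ClosedDisk),
              (U f).1 z = (U 0).1 z + α * f.1 (φ z)) ∨
           (∀ (f : diskAlgebra) (z : ClosedDisk),
              (U f).1 z = (U 0).1 z + α * starRingEnd ℂ (f.1 (conjDisk (φ z)))))) ∧
    -- and both forms do define self-maps of the disk algebra, for all choices of the data
    (∀ (φ : ClosedDisk → ClosedDisk) (α : ℂ) (u : diskAlgebra), IsMobiusOfDisk φ → ‖α‖ = 1 →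
      (∃ U : diskAlgebra → diskAlgebra, ∀ (f : diskAlgebra) (z : ClosedDisk),
          (U f).1 z = u.1 z + α * f.1 (φ z)) ∧
      (∃ U : diskAlgebra → diskAlgebra, ∀ (f : diskAlgebra) (z : ClosedDisk),
          (U f).1 z = u.1 z + α * starRingEnd ℂ (f.1 (conjDisk (φ z))))) := by
  refine ⟨fun U => ⟨fun ⟨hU, hsurj⟩ => ?_, ?_⟩, fun φ α u hφ _ => ?_⟩
  · obtain ⟨T, hT⟩ := exists_linearIsometryEquiv_eq_add hU hsurj
    have hval (f : diskAlgebra) (z : ClosedDisk) : (U f).1 z = (U 0).1 z + (T f).1 z :=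
      congrArg (fun g : diskAlgebra => g.1 z) (hT f)
    obtain ⟨φ, α, hφ, hα, h⟩ := diskAlgebra.exists_isMobiusOfDisk_of_linearIsometryEquiv T
    exact ⟨φ, α, hφ, hα, h.imp (fun h f z => by rw [hval, h]) fun h f z => by rw [hval, h]⟩
  · rintro ⟨φ, α, hφ, hα, hU | hU⟩
    · obtain ⟨C, hC⟩ := hφ.exists_linearIsometryEquiv
      exact isometry_and_surjective_of_eq_add_smul C.toIsometryEquiv hα fun f =>
        diskAlgebra.ext fun z => (hU f z).trans (by rw [← hC]; rfl)
    · obtain ⟨C, hC⟩ := hφ.exists_linearIsometryEquiv_conj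
      exact isometry_and_surjective_of_eq_add_smul C.toIsometryEquiv hα fun f =>
        diskAlgebra.ext fun z => (hU f z).trans (by rw [← hC]; rfl)
  · obtain ⟨C, hC⟩ := hφ.exists_linearIsometryEquiv
    obtain ⟨C', hC'⟩ := hφ.exists_linearIsometryEquiv_conj
    exact ⟨⟨fun f => u + α • C f, fun f z => by rw [← hC]; rfl⟩,
      ⟨fun f => u + α • C' f, fun f z => by rw [← hC']; rfl⟩⟩
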